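/- Let $d\ge 1$ be an integer and $\mathbb{T}^2=\mathbb{C}/(\mathbb{Z}\oplus\mathbb{Z}i)$. For $v\in\mathbb{C}$ let $\#^d_v\mathbb{T}^2$ be the surface obtained from $d$ copies of $\mathbb{T}^2$, labelled by $\mathbb{Z}/d\mathbb{Z}$, by cutting each of them along the projection of the segment $[0,v]$ and regluing: at a point of the slit, other than $[0]$ and $[v]$, through which the projected segment passes $m$ times, the left bank of the slit in the copy $s$ is glued to the right bank in the copy $s+m$ (so $m=1$ if the segment projects injectively); the $d$ copies of $[0]$ are identified to one point, and so are the $d$ copies of $[v]$. It carries the natural map $\pi:\#^d_v\mathbb{T}^2\to\mathbb{T}^2$, the differential $\pi^*dz$ and the corresponding flat metric; the images of $[0]$ and $[v]$ are its cone points. A horizontal (vertical) cylinder of width $w$ and height $h$ is an open subset disjoint from the cone points that is the image of an embedding of $\mathbb{R}/w\mathbb{Z}\times(0,h)$ which is, in flat coordinates, locally a translation (respectively a rotation by $\pi/2$ followed by a translation); it is maximal if it is not properly contained in another cylinder of the same direction. Write $(a,b,\dots)$ for the greatest common divisor, with $(0,d)=d$. **Theorem.** Let $j,k\in\mathbb{Z}$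 be any representatives of a class in $\mathbb{Z}^2/d\mathbb{Z}^2$ and put $g=(j,k,d)$. Then the degenerate surface $\#^d_{j+ik}\mathbb{T}^2$ is a union of $g$ tori with all integer lattice points identified: there are lattices $\Lambda_1,\dots,\Lambda_g\subset\mathbb{Z}\oplus\mathbb{Z}i$ and a homeomorphism, compatible with the projections to $\mathbb{T}^2$, from the space obtained from the disjoint union of the tori $\mathbb{C}/\Lambda_1,\dots,\mathbb{C}/\Lambda_g$ by identifying all images of points of $\mathbb{Z}\oplus\mathbb{Z}i$ to a single point, onto $\#^d_{j+ik}\mathbb{T}^2$. Each of these torus components has area $d/g$ and contains exactly $(k,d)/g$ maximal horizontal cylinders, all of width $d/(k,d)$, and exactly $(j,d)/g$ maximal vertical cylinders, all of width $d/(j,d)$. -/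

import Mathlib

open scoped ENNReal

noncomputable section

namespace DSym

/-- The base lattice `ℤ ⊕ ℤ i` in `ℂ`. -/
def gauss : AddSubgroup ℂ where
  carrier := {z | ∃ m n : ℤ, z = (m : ℂ) + (n : ℂ) * Complex.I}
  zero_mem' := ⟨0, 0, by simp⟩
  add_mem' := by
    rintro _ _ ⟨m, n, rfl⟩ ⟨m', n', rfl⟩
    exact ⟨m + m', n + n', by push_cast; ring⟩
  neg_mem' := by
    rintro _ ⟨m, n, rfl⟩
    exact ⟨-m, -n, by push_cast; ring⟩

/-- The base torus `𝕋² = ℂ / (ℤ ⊕ ℤ i)`. -/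
abbrev BaseTorus : Type := ℂ ⧸ gauss

/-- The determinant of the pair `(v, w)`. Looking in the direction `v` from the origin, the point
`w` lies on the left iff `0 < cross v w` and on the right iff `cross v w < 0`. -/
def cross (v w : ℂ) : ℝ := v.re * w.im - v.im * w.re

/-- The lifts to `ℂ` of the two end points `[0]` and `[v]` of the slit. -/
def endpoints (v : ℂ) : Set ℂ := {z | z ∈ gauss ∨ z - v ∈ gauss}

/-- How many times the projection of the segment `[0, 1] • v` to `𝕋²` passes through `[z]`.
For `v ≠ 0` this is a finite number; it is `0` if `[z]` is off the slit, and `1` at every point of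
the slit if the segment projects injectively. -/
def mult (v z : ℂ) : ℕ :=
  Set.ncard {t : ℝ | t ∈ Set.Icc (0 : ℝ) 1 ∧ z - (t : ℂ) * v ∈ gauss}

/-- `(z, s)` is the point `[z]` of the `s`-th copy of `𝕋²`. All copies of the end point `[0]` of the
slit are identified with each other, and so are all copies of the end point `[v]`. A point in
the interior of the slit belongs to the left bank of the slit in its own copy; it is glued to the
right bank by the topology below. -/
def slitSetoid (d : ℕ) (v : ℂ) : Setoid (ℂ × ZMod d) where
  r a b := a.1 - b.1 ∈ gauss ∧ (a.2 = b.2 ∨ a.1 ∈ endpoints v)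
  iseqv :=
    { refl := fun a => ⟨by simp, Or.inl rfl⟩
      symm := by
        rintro a b ⟨h, h'⟩
        have hs : b.1 - a.1 ∈ gauss := by
          have := gauss.neg_mem h
          rwa [neg_sub] at this
        refine ⟨hs, ?_⟩
        rcases h' with h' | h' | h'
        · exact Or.inl h'.symm
        · refine Or.inr (Or.inl ?_)
          have := gauss.add_mem hs h'
          rwa [sub_add_cancel] at this
        · refine Or.inr (Or.inr ?_)
          have := gauss.add_mem hs h'
          rwa [sub_add_sub_cancel] at this
      trans := by
        rintro a b c ⟨h, h'⟩ ⟨k, k'⟩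
        refine ⟨by have := gauss.add_mem h k; rwa [sub_add_sub_cancel] at this, ?_⟩
        rcases h' with h' | h'
        · rcases k' with k' | k' | k'
          · exact Or.inl (h'.trans k')
          · refine Or.inr (Or.inl ?_)
            have := gauss.add_mem h k'
            rwa [sub_add_cancel] at this
          · refine Or.inr (Or.inr ?_)
            have := gauss.add_mem h k'
            rwa [sub_add_sub_cancel] at this
        · exact Or.inr h' }

/-- The `d`-symmetric surface `#ᵈ_v 𝕋²`: `d` copies of `𝕋²`, labelled by `ℤ/dℤ`, are cut along the
projection of the segment from `0` to `v` and reglued in such a way that crossing the slit once from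
left to right leads from the copy `s` to the copy `s + 1`. At a point that the segment
passes `m` times the slit is crossed `m` times, so one arrives in the copy `s + m`. -/
def Surface (d : ℕ) (v : ℂ) : Type := Quotient (slitSetoid d v)

namespace Surface

variable {d : ℕ} {v : ℂ}

/-- The point `[z]` of the `s`-th copy of `𝕋²`. -/
def mk (d : ℕ) (v : ℂ) (z : ℂ) (s : ZMod d) : Surface d v := Quotient.mk (slitSetoid d v) (z, s)

/-- The label of the copy of `𝕋²` that is reached from the regular point `(z, s)` on the short
straight path to the nearby point `w`. -/
def sheet (v z : ℂ) (s : ZMod d) (w : ℂ) : ZMod d :=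
  open Classical in if cross v (w - z) < 0 then s + (mult v z : ZMod d) else s

/-- The quotient topology of the glued surface: a neighbourhood of a regular point contains a disc
that continues across the slit according to the gluing; a neighbourhood of an end point of the slit
contains a disc (minus the slit) around that point in each of the `d` copies. -/
instance : TopologicalSpace (Surface d v) where
  IsOpen U :=
    (∀ (z : ℂ) (s : ZMod d), z ∉ endpoints v → mk d v z s ∈ U →
      ∃ r > 0, ∀ w ∈ Metric.ball z r, mk d v w (sheet v z s w) ∈ U) ∧
    (∀ (z : ℂ) (s : ZMod d), z ∈ endpoints v → mk d v z s ∈ U →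
      ∃ r > 0, ∀ w ∈ Metric.ball z r, ∀ t : ZMod d, mk d v w t ∈ U)
  isOpen_univ := ⟨fun _ _ _ _ => ⟨1, one_pos, fun _ _ => trivial⟩,
    fun _ _ _ _ => ⟨1, one_pos, fun _ _ _ => trivial⟩⟩
  isOpen_inter := by
    rintro U V ⟨hU, hU'⟩ ⟨hV, hV'⟩
    constructor
    · intro z s hz hs
      obtain ⟨r, hr, h⟩ := hU z s hz hs.1
      obtain ⟨r', hr', h'⟩ := hV z s hz hs.2
      exact ⟨min r r', lt_min hr hr', fun w hw =>
        ⟨h w (Metric.ball_subset_ball (min_le_left _ _) hw),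
          h' w (Metric.ball_subset_ball (min_le_right _ _) hw)⟩⟩
    · intro z s hz hs
      obtain ⟨r, hr, h⟩ := hU' z s hz hs.1
      obtain ⟨r', hr', h'⟩ := hV' z s hz hs.2
      exact ⟨min r r', lt_min hr hr', fun w hw t =>
        ⟨h w (Metric.ball_subset_ball (min_le_left _ _) hw) t,
          h' w (Metric.ball_subset_ball (min_le_right _ _) hw) t⟩⟩
  isOpen_sUnion := by
    intro S hS
    constructor
    · rintro z s hz ⟨U, hU, hs⟩
      obtain ⟨r, hr, h⟩ := (hS U hU).1 z s hz hs
      exact ⟨r, hr, fun w hw => ⟨U, hU, h w hw⟩⟩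
    · rintro z s hz ⟨U, hU, hs⟩
      obtain ⟨r, hr, h⟩ := (hS U hU).2 z s hz hs
      exact ⟨r, hr, fun w hw t => ⟨U, hU, h w hw t⟩⟩

/-- The covering map `π : #ᵈ_v 𝕋² → 𝕋²`. The differential of the surface is `π^* dz`. Hence the
flat structure of the surface is determined by its topology and by `π`. -/
def proj (d : ℕ) (v : ℂ) : Surface d v → BaseTorus :=
  Quotient.lift (fun a => (a.1 : BaseTorus)) (by
    rintro a b ⟨h, -⟩
    refine (QuotientAddGroup.eq).2 ?_
    have := gauss.neg_mem h
    rwa [neg_sub, sub_eq_neg_add] at this)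

/-- The cone points: the images of the end points of the slit. -/
def conePoints (d : ℕ) (v : ℂ) : Set (Surface d v) :=
  {x | ∃ z ∈ endpoints v, ∃ s, x = mk d v z s}

/-- The area of a subset with respect to the pull back of `dx ∧ dy` under `π`: the sum over all
copies of `𝕋²` of the area of the part of the subset that lies in that copy. -/
def area (A : Set (Surface d v)) : ℝ≥0∞ :=
  ∑' s : ZMod d, MeasureTheory.volume
    {z : ℂ | z.re ∈ Set.Ico (0 : ℝ) 1 ∧ z.im ∈ Set.Ico (0 : ℝ) 1 ∧ mk d v z s ∈ A}

/-- `C` is an open cylinder of width (circumference) `w` and height `h` in the direction of the unit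
vector `u`: it is the image of an embedding of `ℝ / wℤ × (0, h)` into the complement of the cone
points which is a translation in the flat coordinates after the rotation by `u`. -/
def IsCylinder (u : ℂ) (w h : ℝ) (C : Set (Surface d v)) : Prop :=
  0 < w ∧ 0 < h ∧ ∃ (f : ℝ × ℝ → Surface d v) (z₀ : ℂ),
    ContinuousOn f (Set.univ ×ˢ Set.Ioo 0 h) ∧
    f '' (Set.univ ×ˢ Set.Ioo 0 h) = C ∧
    C ∩ conePoints d v = ∅ ∧
    (∀ x : ℝ, ∀ y ∈ Set.Ioo 0 h,
      proj d v (f (x, y)) = ((z₀ + u * ((x : ℂ) + (y : ℂ) * Complex.I) : ℂ) : BaseTorus)) ∧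
    (∀ x x' : ℝ, ∀ y ∈ Set.Ioo 0 h, ∀ y' ∈ Set.Ioo 0 h,
      f (x, y) = f (x', y') ↔ y = y' ∧ ∃ n : ℤ, x - x' = n * w)

/-- `C` is a maximal cylinder in the direction `u`. -/
def IsMaximalCylinder (u : ℂ) (C : Set (Surface d v)) : Prop :=
  (∃ w h : ℝ, IsCylinder u w h C) ∧
    ∀ (C' : Set (Surface d v)) (w' h' : ℝ), IsCylinder u w' h' C' → C ⊆ C' → C' = C

end Surface

/-- `Λ` is a lattice in `ℂ`, so that `ℂ / Λ` is a torus. -/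
def IsLattice (Λ : AddSubgroup ℂ) : Prop :=
  DiscreteTopology Λ ∧ Submodule.span ℝ (Λ : Set ℂ) = ⊤

/-- The integer lattice points of a disjoint union of tori. -/
def IsLatticePoint {ι : Type*} {Λ : ι → AddSubgroup ℂ} (x : Σ c, ℂ ⧸ Λ c) : Prop :=
  ∃ z ∈ gauss, x.2 = (z : ℂ ⧸ Λ x.1)

/-- The relation that identifies all integer lattice points of a disjoint union of tori. -/
def toriSetoid {ι : Type*} (Λ : ι → AddSubgroup ℂ) : Setoid (Σ c, ℂ ⧸ Λ c) where
  r x y := x = y ∨ (IsLatticePoint x ∧ IsLatticePoint y)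
  iseqv :=
    { refl := fun _ => Or.inl rfl
      symm := by
        rintro x y (h | ⟨h, h'⟩)
        · exact Or.inl h.symm
        · exact Or.inr ⟨h', h⟩
      trans := by
        rintro x y z (rfl | ⟨h, h'⟩) (rfl | ⟨k, k'⟩)
        · exact Or.inl rfl
        · exact Or.inr ⟨k, k'⟩
        · exact Or.inr ⟨h, h'⟩
        · exact Or.inr ⟨h, k'⟩ }

/-- The union of the tori `ℂ / Λ c` with all integer lattice points identified to one point, with
the quotient topology. -/
abbrev TorusUnion {ι : Type*} (Λ : ι → AddSubgroup ℂ) : Type _ := Quotient (toriSetoid Λ)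

/-- The point of the union of tori represented by the point `z` in the `c`-th torus. -/
def TorusUnion.mk {ι : Type*} (Λ : ι → AddSubgroup ℂ) (c : ι) (z : ℂ) : TorusUnion Λ :=
  Quotient.mk (toriSetoid Λ) ⟨c, (z : ℂ ⧸ Λ c)⟩

end DSym

end

namespace DSym

open Topology

/-! Write `v = n v₀` with `v₀` primitive. The slit is then a closed geodesic of the base torus
traversed `n` times, and its preimage in `ℂ` is the family of lines `cross v₀ z ∈ ℤ` (for `n = 0`
there is no slit). Crossing such a line away from the lattice changes the sheet by `n`, which the
step function `n * ⌊cross v₀ z⌋` compensates. Correcting the sheet label by it gives `d` continuous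
charts `F · s : ℂ → Surface d v`, branched only over lattice points, all of which map to one point
(`exists_isUnfolding`). A lattice translation by `l` shifts the chart label by `cross v l` mod `d`.
So, away from the lattice, the surface is `ℂ × ℤ/d` modulo the lattice. The values `cross v l`
generate `gcd(j,k) ℤ`, so the orbits of labels are the `g` classes mod `g`, each giving a torus `ℂ /
ker` (`IsUnfolding.exists_homeomorph`) made of `d/g` sheets of area 1 (`IsUnfolding.area_range`). A
cylinder in direction `1` or `i` lifts to a strip free of lattice points, hence inside a strip of
height 1 between consecutive lattice lines (`exists_subset_band`). The maximal cylinders are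
therefore the images of unit strips. A unit step along the strip shifts labels by `q = -k` or `q =
j`. With `e = gcd(q,d)`, the strip closes up after length `d/e`, and the strips are indexed by
`ℤ/e`, with `e/g` of them over each class mod `g` (`maximalCylinders`). -/

/-! ### The integer lattice and the determinant form. -/

theorem intCast_mem_gauss (m : ℤ) : (m : ℂ) ∈ gauss := ⟨m, 0, by simp⟩

theorem mk_mem_gauss (m n : ℤ) : (m : ℂ) + (n : ℂ) * Complex.I ∈ gauss := ⟨m, n, rfl⟩

theorem one_le_norm_of_mem_gauss {z : ℂ} (hz : z ∈ gauss) (h0 : z ≠ 0) : 1 ≤ ‖z‖ := by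
  obtain ⟨m, n, rfl⟩ := hz
  by_cases hm : m = 0
  · have hn : n ≠ 0 := by rintro rfl; simp [hm] at h0
    refine le_trans ?_ (Complex.abs_im_le_norm _)
    simpa using (by exact_mod_cast Int.one_le_abs hn : (1 : ℝ) ≤ |(n : ℝ)|)
  · refine le_trans ?_ (Complex.abs_re_le_norm _)
    simpa using (by exact_mod_cast Int.one_le_abs hm : (1 : ℝ) ≤ |(m : ℝ)|)

theorem discreteTopology_of_le_gauss {Λ : AddSubgroup ℂ} (h : Λ ≤ gauss) : DiscreteTopology Λ :=
  DiscreteTopology.of_forall_le_norm one_pos fun x hx =>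
    one_le_norm_of_mem_gauss (h x.2) (by simpa using hx)

theorem isClosed_gauss : IsClosed (gauss : Set ℂ) :=
  haveI := discreteTopology_of_le_gauss le_rfl
  AddSubgroup.isClosed_of_discrete

theorem cross_add (v w w' : ℂ) : cross v (w + w') = cross v w + cross v w' := by
  simp [cross]; ring

theorem cross_sub (v w w' : ℂ) : cross v (w - w') = cross v w - cross v w' := by
  simp [cross]; ring

theorem cross_natCast_mul (n : ℕ) (v w : ℂ) : cross (n * v) w = n * cross v w := by
  simp [cross]; ring

theorem cross_real_mul_self (v : ℂ) (t : ℝ) : cross v (t * v) = 0 := by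
  simp [cross]; ring

theorem cross_mk (j k m n : ℤ) :
    cross (j + k * Complex.I) (m + n * Complex.I) = ((j * n - k * m : ℤ) : ℝ) := by
  simp [cross]

theorem continuous_cross (v : ℂ) : Continuous (cross v) := by
  unfold cross; fun_prop

theorem exists_cross_eq_of_mem_gauss {v w : ℂ} (hv : v ∈ gauss) (hw : w ∈ gauss) :
    ∃ m : ℤ, cross v w = m := by
  obtain ⟨j, k, rfl⟩ := hv
  obtain ⟨m, n, rfl⟩ := hw
  exact ⟨_, cross_mk j k m n⟩

theorem endpoints_eq {v : ℂ} (hv : v ∈ gauss) : endpoints v = gauss := by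
  ext z
  simp only [endpoints, Set.mem_ofPred_eq, SetLike.mem_coe, or_iff_left_iff_imp]
  intro h
  simpa using gauss.add_mem h hv

/-- The class modulo `d` of `cross v w`, for lattice vectors `v` and `w`. -/
noncomputable def crossMod (d : ℕ) (v w : ℂ) : ZMod d := (⌊cross v w⌋ : ℤ)

theorem crossMod_mk (d : ℕ) (j k m n : ℤ) :
    crossMod d (j + k * Complex.I) (m + n * Complex.I) = ((j * n - k * m : ℤ) : ZMod d) := by
  rw [crossMod, cross_mk, Int.floor_intCast]

@[simp] theorem crossMod_zero (d : ℕ) (v : ℂ) : crossMod d v 0 = 0 := by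
  simp [crossMod, cross]

theorem crossMod_add {d : ℕ} {v w w' : ℂ} (hv : v ∈ gauss) (hw : w ∈ gauss) :
    crossMod d v (w + w') = crossMod d v w + crossMod d v w' := by
  obtain ⟨m, hm⟩ := exists_cross_eq_of_mem_gauss hv hw
  simp [crossMod, cross_add, hm]

/-! ### Slit multiplicities and the jumps of the step function. -/

/-- The multiplicity of a slit whose end points are lattice points. -/
theorem mult_eq {a b : ℤ} (hab : IsCoprime a b) (n : ℕ) {z : ℂ} (hz : z ∉ gauss) :
    mult (n * (a + b * Complex.I)) z =
      open Classical in if ∃ m : ℤ, cross (a + b * Complex.I) z = m then n else 0 := by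
  classical
  set v₀ : ℂ := a + b * Complex.I with hv₀
  have hv₀g : v₀ ∈ gauss := mk_mem_gauss a b
  have hv₀0 : v₀ ≠ 0 := by
    intro h
    have ha : a = 0 := by simpa [hv₀] using congrArg Complex.re h
    have hb : b = 0 := by simpa [hv₀] using congrArg Complex.im h
    rw [ha, hb, isCoprime_zero_left] at hab
    exact not_isUnit_zero hab
  rcases Nat.eq_zero_or_pos n with rfl | hn
  · simp [mult, hz]
  have hn' : (n : ℝ) ≠ 0 := by positivity
  split_ifs with hx
  · obtain ⟨m, hm⟩ := hx
    obtain ⟨e, f, hef⟩ := hab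
    -- a lattice point on the same line parallel to the slit
    set l : ℂ := ((-(f * m) : ℤ) : ℂ) + ((e * m : ℤ) : ℂ) * Complex.I with hl
    have hlg : l ∈ gauss := mk_mem_gauss _ _
    have hcl : cross v₀ (z - l) = 0 := by
      rw [cross_sub, hm, hl, hv₀, cross_mk]
      have : m = a * (e * m) - b * -(f * m) := by linear_combination (-m) * hef
      rw [sub_eq_zero]; exact_mod_cast this
    obtain ⟨τ, hτ⟩ : ∃ τ : ℝ, z - l = τ * v₀ := by
      refine ⟨((z - l) / v₀).re, ?_⟩
      have him : ((z - l) / v₀).im = 0 := by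
        have h1 : (z - l).re * v₀.im = (z - l).im * v₀.re := by
          simp only [cross] at hcl; linarith
        rw [Complex.div_im, ← h1]; ring
      have : (((z - l) / v₀).re : ℂ) = (z - l) / v₀ := Complex.ext (by simp) (by simp [him])
      rw [this, div_mul_cancel₀ _ hv₀0]
    -- Primitivity enters here: if `t a = p` and `t b = q` are integers, Bézout gives `t = e p + f
    -- q`.
    have hprim : ∀ t : ℝ, (t : ℂ) * v₀ ∈ gauss ↔ ∃ p : ℤ, t = p := by
      intro t
      constructor
      · rintro ⟨p, q, hpq⟩
        have h1 : t * a = p := by simpa [hv₀] using congrArg Complex.re hpq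
        have h2 : t * b = q := by simpa [hv₀] using congrArg Complex.im hpq
        refine ⟨e * p + f * q, ?_⟩
        have : ((e * a + f * b : ℤ) : ℝ) = 1 := by rw [hef]; simp
        push_cast at this ⊢
        rw [← h1, ← h2]
        linear_combination (-t) * this
      · rintro ⟨p, rfl⟩
        refine ⟨p * a, p * b, ?_⟩
        rw [hv₀]; push_cast; ring
    have hmem : ∀ t : ℝ, z - (t : ℂ) * (n * v₀) ∈ gauss ↔ ∃ p : ℤ, τ - t * n = p := by
      intro t
      rw [← hprim]
      have : z - (t : ℂ) * (n * v₀) = ((τ - t * n : ℝ) : ℂ) * v₀ + l := by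
        push_cast; linear_combination hτ
      rw [this, gauss.add_mem_cancel_right hlg]
    have hτ' : ∀ p : ℤ, τ ≠ p := by
      intro p hp
      have h1 := gauss.add_mem ((hprim τ).2 ⟨p, hp⟩) hlg
      rw [← hτ, sub_add_cancel] at h1
      exact hz h1
    -- The passages correspond to the integers `p = τ - t n` in `[τ - n, τ]`. As `τ` is not an
    -- integer, both ends are strict and exactly `n` values remain.
    have hset : {t : ℝ | t ∈ Set.Icc (0 : ℝ) 1 ∧ z - (t : ℂ) * (n * v₀) ∈ gauss} =
        (fun p : ℤ => (τ - p) / n) '' (Finset.Ioc (⌊τ⌋ - n) ⌊τ⌋ : Finset ℤ) := by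
      ext t
      simp only [Set.mem_ofPred_eq, hmem, Set.mem_image, Finset.coe_Ioc, Set.mem_Ioc, Set.mem_Icc]
      have hnpos : (0 : ℝ) < n := by positivity
      constructor
      · rintro ⟨⟨h0, h1⟩, p, hp⟩
        refine ⟨p, ⟨?_, ?_⟩, ?_⟩
        · rw [sub_lt_iff_lt_add, Int.floor_lt]
          have := hτ' (p + n)
          push_cast at this ⊢
          refine lt_of_le_of_ne ?_ this
          nlinarith
        · rw [Int.le_floor]; nlinarith
        · rw [← hp]; field_simp; ring
      · rintro ⟨p, ⟨h0, h1⟩, rfl⟩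
        rw [sub_lt_iff_lt_add, Int.floor_lt] at h0
        rw [Int.le_floor] at h1
        push_cast at h0
        refine ⟨⟨div_nonneg (by linarith) hnpos.le, (div_le_one hnpos).2 (by linarith)⟩, p, ?_⟩
        field_simp; ring
    rw [mult, hset, Set.InjOn.ncard_image, Set.ncard_coe_finset, Int.card_Ioc]
    · simp
    · intro p _ q _ hpq
      have := (div_left_inj' hn').1 hpq
      exact_mod_cast (by linarith : (p : ℝ) = q)
  · rw [mult]
    convert Set.ncard_empty ℝ
    rw [Set.eq_empty_iff_forall_notMem]
    rintro t ⟨-, ht⟩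
    obtain ⟨m, hm⟩ := exists_cross_eq_of_mem_gauss hv₀g ht
    refine hx ⟨m, ?_⟩
    have : (t : ℂ) * (n * v₀) = ((t * n : ℝ) : ℂ) * v₀ := by push_cast; ring
    rw [cross_sub, this, cross_real_mul_self, sub_zero] at hm
    exact hm

/-- Near `z` the floor can only drop, and only when `z` lies on an integer line and `w` is to its
right. This is the same sign test by which `Surface.sheet` adds the multiplicity. -/
theorem eventually_floor_cross (v z : ℂ) :
    ∀ᶠ w in 𝓝 z, ⌊cross v w⌋ =
      open Classical in
      if (∃ m : ℤ, cross v z = m) ∧ cross v (w - z) < 0 then ⌊cross v z⌋ - 1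
      else ⌊cross v z⌋ := by
  have hc : Filter.Tendsto (cross v) (𝓝 z) (𝓝 (cross v z)) := (continuous_cross v).tendsto z
  by_cases hm : ∃ m : ℤ, cross v z = m
  · obtain ⟨m, hm⟩ := hm
    have h1 := hc.eventually (lt_mem_nhds (show cross v z - 1 < cross v z by linarith))
    have h2 := hc.eventually (gt_mem_nhds (show cross v z < cross v z + 1 by linarith))
    filter_upwards [h1, h2] with w h1 h2
    rw [cross_sub]
    rw [hm] at h1 h2 ⊢
    split_ifs with h
    · rw [Int.floor_eq_iff, Int.floor_intCast]; push_cast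
      exact ⟨by linarith, by linarith [h.2]⟩
    · have : (m : ℝ) ≤ cross v w := by
        by_contra hlt
        exact h ⟨⟨m, rfl⟩, by linarith⟩
      rw [Int.floor_eq_iff, Int.floor_intCast]
      exact ⟨by linarith, by linarith⟩
  · have h0 : (⌊cross v z⌋ : ℝ) < cross v z :=
      lt_of_le_of_ne (Int.floor_le _) fun h => hm ⟨_, h.symm⟩
    have h1 := hc.eventually (lt_mem_nhds h0)
    have h2 := hc.eventually (gt_mem_nhds (Int.lt_floor_add_one (cross v z)))
    filter_upwards [h1, h2] with w h1 h2
    rw [if_neg fun h => hm h.1, Int.floor_eq_iff]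
    exact ⟨h1.le, h2⟩

/-! ### Unfolding the surface into charts on the plane. -/

/-- `F z s`, for `s` in `ZMod d`, are `d` charts of the surface that are defined on all of `ℂ`; they
are branched at the lattice points only, and they are permuted by the lattice translations. -/
structure IsUnfolding (d : ℕ) (v : ℂ) (F : ℂ → ZMod d → Surface d v) : Prop where
  isOpen_iff : ∀ U, IsOpen U ↔ ∀ s, IsOpen {z | F z s ∈ U}
  eq_iff : ∀ z z' s s', F z s = F z' s' ↔
    z - z' ∈ gauss ∧ (z ∈ gauss ∨ s - s' = crossMod d v (z - z'))
  proj_eq : ∀ z s, Surface.proj d v (F z s) = (z : BaseTorus)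
  mem_conePoints : ∀ z s, F z s ∈ Surface.conePoints d v ↔ z ∈ gauss
  -- The congruence says that sheet and chart labels agree modulo any divisor `g` of `d` dividing
  -- all holonomies; the area count needs this to pass from charts to sheets.
  exists_eq : ∀ z s, ∃ t, Surface.mk d v z s = F z t ∧
    ∀ g : ℕ, ∀ hg : g ∣ d, (∀ l ∈ gauss, ∃ m : ℤ, cross v l = g * m) →
      ZMod.castHom hg (ZMod g) t = ZMod.castHom hg (ZMod g) s

theorem Surface.mk_eq_iff {d : ℕ} {v : ℂ} (hv : v ∈ gauss) {z z' : ℂ} {s s' : ZMod d} :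
    Surface.mk d v z s = Surface.mk d v z' s' ↔ z - z' ∈ gauss ∧ (s = s' ∨ z ∈ gauss) := by
  refine (Quotient.eq (r := slitSetoid d v)).trans ?_
  change z - z' ∈ gauss ∧ (s = s' ∨ z ∈ endpoints v) ↔ _
  rw [endpoints_eq hv]; rfl

theorem exists_primitive (j k : ℤ) : ∃ (n : ℕ) (a b : ℤ), IsCoprime a b ∧ j = n * a ∧ k = n * b := by
  rcases Nat.eq_zero_or_pos (Int.gcd j k) with h | h
  · obtain ⟨rfl, rfl⟩ := Int.gcd_eq_zero_iff.1 h
    -- The zero vector is given multiplicity 0 along an arbitrary primitive direction, so the empty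
    -- slit needs no separate construction.
    exact ⟨0, 1, 0, isCoprime_one_left, by simp, by simp⟩
  · obtain ⟨a, b, hab, ha, hb⟩ := Int.exists_gcd_one h
    exact ⟨Int.gcd j k, a, b, Int.isCoprime_iff_gcd_eq_one.2 hab, by rw [mul_comm]; exact ha,
      by rw [mul_comm]; exact hb⟩

/-- The charts are `Surface.mk d v z (s - N z)`: where a short path crosses the slit to the right,
`N` drops by `n` while the sheet rises by `n`. The floor is taken of `cross v₀`, not `cross v`,
because the latter also jumps on lines that miss the slit when `n > 1`. -/
theorem exists_isUnfolding (d : ℕ) (hd : 1 ≤ d) {v : ℂ} (hv : v ∈ gauss) :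
    ∃ F : ℂ → ZMod d → Surface d v, IsUnfolding d v F := by
  classical
  have : NeZero d := ⟨by omega⟩
  obtain ⟨j, k, hjk⟩ := id hv
  obtain ⟨n, a, b, hab, rfl, rfl⟩ := exists_primitive j k
  set v₀ : ℂ := a + b * Complex.I with hv₀
  have hv₀g : v₀ ∈ gauss := mk_mem_gauss a b
  have hvn : v = n * v₀ := by rw [hjk, hv₀]; push_cast; ring
  set N : ℂ → ZMod d := fun z => n * (⌊cross v₀ z⌋ : ℤ) with hN
  have hNadd : ∀ z l, l ∈ gauss → N (z + l) = N z + crossMod d v l := by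
    intro z l hl
    obtain ⟨m, hm⟩ := exists_cross_eq_of_mem_gauss hv₀g hl
    have : crossMod d v l = n * (m : ZMod d) := by
      have : cross v l = ((n * m : ℤ) : ℝ) := by
        rw [hvn, cross_natCast_mul, hm]; push_cast; ring
      rw [crossMod, this, Int.floor_intCast]; push_cast; ring
    simp only [hN, cross_add, hm, Int.floor_add_intCast, this]
    push_cast; ring
  -- moving along a short path from a regular point does not change the chart
  have hsheet : ∀ z s, z ∉ gauss → ∀ᶠ w in 𝓝 z,
      Surface.sheet v z (s - N z) w = s - N w := by
    intro z s hz
    filter_upwards [eventually_floor_cross v₀ z] with w hw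
    rw [Surface.sheet, hvn, mult_eq hab n hz, cross_natCast_mul]
    simp only [hN, hw, ← hv₀]
    rcases Nat.eq_zero_or_pos n with rfl | hn
    · simp
    have hn' : (0 : ℝ) < n := by exact_mod_cast hn
    have hneg : (n : ℝ) * cross v₀ (w - z) < 0 ↔ cross v₀ (w - z) < 0 := by
      constructor
      · intro h; by_contra h'; push Not at h'; exact absurd h (not_lt.2 (by positivity))
      · intro h; exact mul_neg_of_pos_of_neg hn' h
    simp only [hneg]
    by_cases h1 : cross v₀ (w - z) < 0 <;> by_cases h2 : ∃ m : ℤ, cross v₀ z = m <;>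
      simp only [h1, h2, if_true, if_false, and_true, and_false, Int.cast_sub,
        Int.cast_one, Nat.cast_zero] <;> ring
  refine ⟨fun z s => Surface.mk d v z (s - N z), ?_, ?_, ?_, ?_, ?_⟩
  · intro U
    change ((∀ (z : ℂ) (s : ZMod d), z ∉ endpoints v → Surface.mk d v z s ∈ U →
      ∃ r > 0, ∀ w ∈ Metric.ball z r, Surface.mk d v w (Surface.sheet v z s w) ∈ U) ∧
      (∀ (z : ℂ) (s : ZMod d), z ∈ endpoints v → Surface.mk d v z s ∈ U →
      ∃ r > 0, ∀ w ∈ Metric.ball z r, ∀ t : ZMod d, Surface.mk d v w t ∈ U)) ↔ _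
    rw [endpoints_eq hv]
    simp only [← Metric.eventually_nhds_iff_ball, isOpen_iff_eventually, Set.mem_ofPred_eq,
      SetLike.mem_coe]
    constructor
    · rintro ⟨h1, h2⟩ s z hz
      by_cases hzg : z ∈ gauss
      · filter_upwards [h2 z _ hzg hz] with w hw using hw _
      · filter_upwards [h1 z _ hzg hz, hsheet z s hzg] with w hw hw'
        rwa [hw'] at hw
    · intro h
      constructor
      · intro z s hz hs
        have h1 := h (s + N z) z (show Surface.mk d v z (s + N z - N z) ∈ U by rwa [add_sub_cancel_right])
        filter_upwards [h1, hsheet z (s + N z) hz] with w hw hw'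
        rw [← hw', add_sub_cancel_right] at hw
        exact hw
      · intro z s hz hs
        -- All sheets meet at a lattice point, so the conditions in the finitely many charts hold on
        -- a common neighbourhood.
        have : ∀ᶠ w in 𝓝 z, ∀ t, Surface.mk d v w (t - N w) ∈ U := by
          rw [Filter.eventually_all]
          intro t
          refine h t z (show Surface.mk d v z (t - N z) ∈ U from ?_)
          rwa [(Surface.mk_eq_iff hv (z := z) (z' := z) (s' := s)).2 ⟨by simp, Or.inr hz⟩]
        filter_upwards [this] with w hw t
        simpa using hw (t + N w)
  · intro z z' s s'
    rw [Surface.mk_eq_iff hv]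
    refine and_congr_right fun h => ?_
    rw [or_comm]
    refine or_congr Iff.rfl ?_
    have := hNadd z' (z - z') h
    rw [add_sub_cancel] at this
    rw [this]
    constructor
    · intro h; linear_combination h
    · intro h; linear_combination h
  · intro z s; rfl
  · intro z s
    simp only [Surface.conePoints, endpoints_eq hv, Set.mem_ofPred_eq, SetLike.mem_coe,
      Surface.mk_eq_iff hv]
    constructor
    · rintro ⟨z', hz', t, h, -⟩
      simpa using gauss.add_mem h hz'
    · intro hz
      exact ⟨z, hz, s, by simp, Or.inr hz⟩
  · intro z s
    refine ⟨s + N z, by simp, fun g hg h => ?_⟩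
    -- Since `a e + b f = 1` after destructuring, the lattice vector `-f + e i` has `cross v₀` equal
    -- to 1, hence holonomy exactly `n`.
    have hgn : (g : ℤ) ∣ n := by
      obtain ⟨e, f, hef⟩ := hab
      obtain ⟨m, hm⟩ := h _ (mk_mem_gauss (-f) e)
      refine ⟨m, ?_⟩
      rw [hvn, cross_natCast_mul, hv₀, cross_mk] at hm
      have hm' : (n : ℤ) * (a * e - b * -f) = g * m := by exact_mod_cast hm
      linear_combination hm' - (n : ℤ) * hef
    have hn0 : (n : ZMod g) = 0 := by
      rw [ZMod.natCast_eq_zero_iff]; exact_mod_cast hgn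
    rw [map_add, hN, map_mul, map_natCast, hn0, zero_mul, add_zero]

/-! ### Arithmetic of labels modulo `d`. -/

/-- By Bézout, `gcd(q,d)` is a multiple of `q` modulo `d`, so both generate the same subgroup of
`ZMod d`. -/
theorem castHom_eq_zero_iff {q : ℤ} {d e : ℕ} (he : e = Int.gcd q d) (hed : e ∣ d) (s : ZMod d) :
    ZMod.castHom hed (ZMod e) s = 0 ↔ ∃ m : ℤ, s = m * q := by
  obtain ⟨x, rfl⟩ := ZMod.intCast_surjective s
  constructor
  · intro h
    rw [map_intCast, ZMod.intCast_zmod_eq_zero_iff_dvd] at h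
    obtain ⟨y, rfl⟩ := h
    refine ⟨Int.gcdA q d * y, ?_⟩
    rw [he, Int.gcd_eq_gcd_ab]
    push_cast
    rw [ZMod.natCast_self]
    ring
  · rintro ⟨m, hm⟩
    have hq : (q : ZMod e) = 0 := by
      rw [ZMod.intCast_zmod_eq_zero_iff_dvd, he]
      exact Int.gcd_dvd_left ..
    rw [hm, map_mul, map_intCast, map_intCast, hq, mul_zero]

/-- The integers `j n - k m` are exactly the multiples of `gcd(j,k)`. Hence two chart labels are
related by a lattice translation precisely when they agree mod `g`, which is why there are `g` tori.
-/
theorem castHom_eq_zero_iff_crossMod {j k : ℤ} {d g : ℕ} (hg : g = Nat.gcd (Int.gcd j k) d)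
    (hgd : g ∣ d) (s : ZMod d) :
    ZMod.castHom hgd (ZMod g) s = 0 ↔
      ∃ l ∈ gauss, s = crossMod d (j + k * Complex.I) l := by
  rw [castHom_eq_zero_iff (q := (Int.gcd j k : ℤ)) (by rw [hg, Int.gcd_natCast_natCast])]
  constructor
  · rintro ⟨m, rfl⟩
    refine ⟨_, mk_mem_gauss (-(m * Int.gcdB j k)) (m * Int.gcdA j k), ?_⟩
    rw [crossMod_mk, ← Int.cast_mul, Int.gcd_eq_gcd_ab]
    congr 1; ring
  · rintro ⟨_, ⟨m, n, rfl⟩, rfl⟩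
    obtain ⟨a, ha⟩ := Int.gcd_dvd_left j k
    obtain ⟨b, hb⟩ := Int.gcd_dvd_right j k
    refine ⟨a * n - b * m, ?_⟩
    rw [crossMod_mk, ← Int.cast_mul]
    congr 1
    linear_combination n * ha - m * hb

theorem card_castHom_fiber {d g : ℕ} [NeZero d] [NeZero g] (hg : g ∣ d) (c : ZMod g) :
    (Finset.univ.filter fun s : ZMod d => ZMod.castHom hg (ZMod g) s = c).card = d / g := by
  have h := Finset.card_eq_sum_card_fiberwise (f := ZMod.castHom hg (ZMod g))
    (s := (Finset.univ : Finset (ZMod d))) (t := Finset.univ) (fun _ _ => Finset.mem_univ _)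
  have hr : ∀ x : ZMod g, x ∈ Set.range (ZMod.castHom hg (ZMod g)) :=
    fun x => ZMod.castHom_surjective hg x
  rw [Finset.sum_congr rfl fun x _ =>
    AddMonoidHom.card_fiber_eq_of_mem_range (ZMod.castHom hg (ZMod g)) (hr x) (hr c)] at h
  rw [Finset.sum_const, Finset.card_univ, Finset.card_univ, ZMod.card, ZMod.card, smul_eq_mul] at h
  conv_rhs => rw [h]
  rw [Nat.mul_div_cancel_left _ (Nat.pos_of_neZero g)]

theorem exists_homeomorph_of_isQuotientMap {X Y Z : Type*} [TopologicalSpace X]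
    [TopologicalSpace Y] [TopologicalSpace Z] {p : X → Y} {q : X → Z} (hp : IsQuotientMap p)
    (hq : IsQuotientMap q) (h : ∀ x y, p x = p y ↔ q x = q y) :
    ∃ φ : Y ≃ₜ Z, ∀ x, φ (p x) = q x := by
  have hpr := Function.surjInv_eq hp.surjective
  have hqr := Function.surjInv_eq hq.surjective
  have h1 : ∀ x, q (Function.surjInv hp.surjective (p x)) = q x := fun x => (h _ _).1 (hpr _)
  have h2 : ∀ x, p (Function.surjInv hq.surjective (q x)) = p x := fun x => (h _ _).2 (hqr _)
  refine ⟨⟨⟨fun y => q (Function.surjInv hp.surjective y),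
    fun z => p (Function.surjInv hq.surjective z), ?_, ?_⟩, ?_, ?_⟩, h1⟩
  · intro y
    change p (Function.surjInv hq.surjective (q _)) = y
    rw [h2, hpr]
  · intro z
    change q (Function.surjInv hp.surjective (p _)) = z
    rw [h1, hqr]
  · rw [hp.continuous_iff]
    exact hq.continuous.congr fun x => (h1 x).symm
  · rw [hq.continuous_iff]
    exact hp.continuous.congr fun x => (h2 x).symm

/-! ### The decomposition into tori. -/

/-- The lattice vectors along which the slits are crossed `0` times modulo `d`. -/
noncomputable def crossKernel (d : ℕ) {v : ℂ} (hv : v ∈ gauss) : AddSubgroup ℂ where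
  carrier := {l | l ∈ gauss ∧ crossMod d v l = 0}
  zero_mem' := ⟨gauss.zero_mem, crossMod_zero d v⟩
  add_mem' := by
    rintro a b ⟨ha, ha'⟩ ⟨hb, hb'⟩
    exact ⟨gauss.add_mem ha hb, by rw [crossMod_add hv ha, ha', hb', add_zero]⟩
  neg_mem' := by
    rintro a ⟨ha, ha'⟩
    refine ⟨gauss.neg_mem ha, ?_⟩
    have := crossMod_add (d := d) (w' := -a) hv ha
    rwa [add_neg_cancel, crossMod_zero, ha', zero_add, eq_comm] at this

theorem mem_crossKernel {d : ℕ} {v : ℂ} {hv : v ∈ gauss} {l : ℂ} :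
    l ∈ crossKernel d hv ↔ l ∈ gauss ∧ crossMod d v l = 0 := Iff.rfl

theorem crossKernel_le (d : ℕ) {v : ℂ} (hv : v ∈ gauss) : crossKernel d hv ≤ gauss :=
  fun _ h => h.1

/-- The kernel contains `d` times the Gaussian lattice, and `d` and `d i` already span `ℂ` over `ℝ`.
-/
theorem isLattice_crossKernel {d : ℕ} (hd : 1 ≤ d) {v : ℂ} (hv : v ∈ gauss) :
    IsLattice (crossKernel d hv) := by
  refine ⟨discreteTopology_of_le_gauss (crossKernel_le d hv), ?_⟩
  have hmem : ∀ m n : ℤ, ((d * m : ℤ) : ℂ) + ((d * n : ℤ) : ℂ) * Complex.I ∈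
      crossKernel d hv := by
    intro m n
    refine ⟨mk_mem_gauss _ _, ?_⟩
    obtain ⟨j, k, rfl⟩ := id hv
    rw [crossMod_mk]
    push_cast
    rw [ZMod.natCast_self]
    ring
  have hd0 : (d : ℝ) ≠ 0 := by positivity
  rw [Submodule.eq_top_iff']
  intro z
  have h1 := Submodule.smul_mem _ (z.re / d) (Submodule.subset_span (R := ℝ) (hmem 1 0))
  have h2 := Submodule.smul_mem _ (z.im / d) (Submodule.subset_span (R := ℝ) (hmem 0 1))
  convert Submodule.add_mem _ h1 h2 using 1
  apply Complex.ext <;> simp <;> field_simp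

theorem isLatticePoint_iff {ι : Type*} {Λ : ι → AddSubgroup ℂ} (h : ∀ c, Λ c ≤ gauss) (c : ι)
    (z : ℂ) : IsLatticePoint (Λ := Λ) ⟨c, (z : ℂ ⧸ Λ c)⟩ ↔ z ∈ gauss := by
  constructor
  · rintro ⟨w, hw, hzw⟩
    have := gauss.sub_mem hw (h c (QuotientAddGroup.eq.1 hzw))
    simpa using this
  · intro hz
    exact ⟨z, hz, rfl⟩

theorem TorusUnion.mk_eq_iff {ι : Type*} {Λ : AddSubgroup ℂ} (h : Λ ≤ gauss) {c c' : ι} {z z' : ℂ} :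
    TorusUnion.mk (fun _ => Λ) c z = TorusUnion.mk (fun _ => Λ) c' z' ↔
      (c = c' ∧ z - z' ∈ Λ) ∨ (z ∈ gauss ∧ z' ∈ gauss) := by
  refine Quotient.eq.trans (or_congr ?_ (and_congr (isLatticePoint_iff (fun _ => h) _ _)
    (isLatticePoint_iff (fun _ => h) _ _)))
  rw [Sigma.mk.injEq]
  refine and_congr_right fun _ => ?_
  rw [heq_eq_eq, QuotientAddGroup.eq, ← Λ.neg_mem_iff]
  simp [sub_eq_add_neg, add_comm]

theorem TorusUnion.isQuotientMap_mk {ι : Type*} (Λ : ι → AddSubgroup ℂ) :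
    IsQuotientMap fun p : (Σ _ : ι, ℂ) => TorusUnion.mk Λ p.1 p.2 := by
  have h : IsQuotientMap (Sigma.map id fun c (z : ℂ) => (z : ℂ ⧸ Λ c) :
      (Σ _ : ι, ℂ) → Σ c, ℂ ⧸ Λ c) := by
    refine IsOpenMap.isQuotientMap ?_ ?_ ?_
    · exact isOpenMap_sigma_map.2 fun c => QuotientAddGroup.isOpenMap_coe
    · exact Continuous.sigma_map fun c => QuotientAddGroup.continuous_mk
    · exact Function.surjective_id.sigma_map fun c => QuotientAddGroup.mk_surjective
  exact isQuotientMap_quotient_mk'.comp h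

namespace IsUnfolding

variable {d : ℕ} {v : ℂ} {F : ℂ → ZMod d → Surface d v}

theorem surjective (hF : IsUnfolding d v F) (x : Surface d v) : ∃ z s, x = F z s := by
  obtain ⟨⟨z, s⟩, rfl⟩ := Quotient.exists_rep x
  obtain ⟨t, ht, -⟩ := hF.exists_eq z s
  exact ⟨z, t, ht⟩

/-- The alternative `z ∈ gauss` is needed because the common lattice point belongs to every torus.
-/
theorem mem_range_iff {j k : ℤ} (hF : IsUnfolding d v F) (hv : v = j + k * Complex.I) {g : ℕ}
    (hg : g = Nat.gcd (Int.gcd j k) d) (hgd : g ∣ d) (z : ℂ) (s c : ZMod d) :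
    F z s ∈ Set.range (fun z => F z c) ↔
      z ∈ gauss ∨ ZMod.castHom hgd (ZMod g) s = ZMod.castHom hgd (ZMod g) c := by
  rw [eq_comm (a := ZMod.castHom hgd (ZMod g) s), ← sub_eq_zero, ← map_sub,
    castHom_eq_zero_iff_crossMod hg, ← hv]
  constructor
  · rintro ⟨w, hw⟩
    obtain ⟨h1, h2 | h2⟩ := (hF.eq_iff _ _ _ _).1 hw
    · left; simpa using gauss.sub_mem h2 h1
    · exact Or.inr ⟨_, h1, h2⟩
  · rintro (h | ⟨l, hl, h⟩)
    · exact ⟨z, (hF.eq_iff _ _ _ _).2 ⟨by simp, Or.inl h⟩⟩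
    · exact ⟨z + l, (hF.eq_iff _ _ _ _).2 ⟨by simpa, Or.inr (by simpa)⟩⟩

/-- Both spaces are quotients of `g` disjoint planes by the same relation: equal labels in `Fin g`
force the holonomy of the translation to vanish, and congruence mod `g` forces equal labels. -/
theorem exists_homeomorph {j k : ℤ} (hd : 1 ≤ d) (hF : IsUnfolding d v F) (hvg : v ∈ gauss)
    (hv : v = j + k * Complex.I) {g : ℕ} (hg : g = Nat.gcd (Int.gcd j k) d) :
    ∃ φ : TorusUnion (fun _ : Fin g => crossKernel d hvg) ≃ₜ Surface d v,
      ∀ c z, φ (TorusUnion.mk _ c z) = F z (c : ℕ) := by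
  have hgd : g ∣ d := hg ▸ Nat.gcd_dvd_right _ _
  have : NeZero g := ⟨by rintro rfl; simp at hgd; omega⟩
  have hq : IsQuotientMap fun p : (Σ _ : Fin g, ℂ) => F p.2 ((p.1 : ℕ) : ZMod d) := by
    -- Each of the `d` charts is a lattice translate of one of the first `g`, so these already
    -- detect the topology and cover the surface.
    have key : ∀ s : ZMod d, ∃ c : Fin g, ∃ l ∈ gauss, ∀ z, F z s = F (z + l) ((c : ℕ)) := by
      intro s
      let x := ZMod.castHom hgd (ZMod g) s
      have h : ZMod.castHom hgd (ZMod g) (((x.val : ℕ) : ZMod d) - s) = 0 := by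
        rw [map_sub, map_natCast, ZMod.natCast_zmod_val, sub_self]
      obtain ⟨l, hl, h⟩ := (castHom_eq_zero_iff_crossMod hg hgd _).1 h
      refine ⟨⟨x.val, x.val_lt⟩, l, hl, fun z => ?_⟩
      refine ((hF.eq_iff _ _ _ _).2 ⟨by simpa, Or.inr ?_⟩).symm
      simpa [hv] using h
    rw [isQuotientMap_iff]
    refine ⟨?_, ?_⟩
    · rw [isCoinducing_iff]
      intro U
      rw [isOpen_sigma_iff, hF.isOpen_iff]
      constructor
      · intro h s
        obtain ⟨c, l, -, hcl⟩ := key s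
        simp only [hcl]
        exact (h c).preimage (continuous_id.add continuous_const)
      · intro h c
        exact h ((c : ℕ) : ZMod d)
    · intro x
      obtain ⟨z, s, rfl⟩ := hF.surjective x
      obtain ⟨c, l, -, h⟩ := key s
      exact ⟨⟨c, z + l⟩, (h z).symm⟩
  suffices h : ∀ p p' : (Σ _ : Fin g, ℂ),
      TorusUnion.mk (fun _ => crossKernel d hvg) p.1 p.2 =
        TorusUnion.mk (fun _ => crossKernel d hvg) p'.1 p'.2 ↔
      F p.2 ((p.1 : ℕ) : ZMod d) = F p'.2 ((p'.1 : ℕ) : ZMod d) by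
    obtain ⟨φ, hφ⟩ := exists_homeomorph_of_isQuotientMap
      (TorusUnion.isQuotientMap_mk (fun _ : Fin g => crossKernel d hvg)) hq h
    exact ⟨φ, fun c z => hφ ⟨c, z⟩⟩
  rintro ⟨c, z⟩ ⟨c', z'⟩
  rw [TorusUnion.mk_eq_iff (crossKernel_le d hvg), hF.eq_iff, mem_crossKernel]
  constructor
  · rintro (⟨rfl, h, h'⟩ | ⟨h, h'⟩)
    · exact ⟨h, Or.inr (by rw [sub_self]; exact h'.symm)⟩
    · exact ⟨gauss.sub_mem h h', Or.inl h⟩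
  · rintro ⟨h, h' | h'⟩
    · exact Or.inr ⟨h', by simpa using gauss.sub_mem h' h⟩
    · left
      have hc : c = c' := by
        have h1 := (castHom_eq_zero_iff_crossMod hg hgd _).2 ⟨_, h, h'.trans (by rw [hv])⟩
        rw [map_sub, map_natCast, map_natCast, sub_eq_zero,
          ZMod.natCast_eq_natCast_iff', Nat.mod_eq_of_lt c.2, Nat.mod_eq_of_lt c'.2] at h1
        exact Fin.ext h1
      subst hc
      exact ⟨rfl, h, by rw [← h', sub_self]⟩

end IsUnfolding

/-! ### The area of a component. -/

theorem volume_unitSquare :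
    MeasureTheory.volume {z : ℂ | z.re ∈ Set.Ico (0 : ℝ) 1 ∧ z.im ∈ Set.Ico (0 : ℝ) 1} = 1 := by
  have := Complex.volume_preserving_equiv_real_prod.measure_preimage_equiv
    (Set.Ico (0 : ℝ) 1 ×ˢ Set.Ico (0 : ℝ) 1)
  rw [MeasureTheory.Measure.volume_eq_prod, MeasureTheory.Measure.prod_prod] at this
  simp only [Real.volume_Ico, sub_zero, ENNReal.ofReal_one, mul_one] at this
  exact this

theorem volume_gauss : MeasureTheory.volume (gauss : Set ℂ) = 0 := by
  refine Set.Countable.measure_zero ?_ _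
  have : (gauss : Set ℂ) = Set.range fun p : ℤ × ℤ => (p.1 : ℂ) + p.2 * Complex.I := by
    ext z
    constructor
    · rintro ⟨m, n, rfl⟩; exact ⟨(m, n), rfl⟩
    · rintro ⟨⟨m, n⟩, rfl⟩; exact ⟨m, n, rfl⟩
  rw [this]
  exact Set.countable_range _

/-- Up to the null set of lattice points, a sheet lies entirely in the torus or entirely outside it,
according to its label mod `g`; a fibre of `ZMod d → ZMod g` has `d/g` elements. -/
theorem IsUnfolding.area_range {d : ℕ} {v : ℂ} {F : ℂ → ZMod d → Surface d v} {j k : ℤ}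
    (hd : 1 ≤ d) (hF : IsUnfolding d v F) (hv : v = j + k * Complex.I) {g : ℕ}
    (hg : g = Nat.gcd (Int.gcd j k) d) (c : ZMod d) :
    Surface.area (Set.range fun z => F z c) = (d : ℝ≥0∞) / (g : ℝ≥0∞) := by
  classical
  have hgd : g ∣ d := hg ▸ Nat.gcd_dvd_right _ _
  have : NeZero d := ⟨by omega⟩
  have : NeZero g := ⟨by rintro rfl; simp at hgd; omega⟩
  have hcross : ∀ l ∈ gauss, ∃ m : ℤ, cross v l = g * m := by
    rintro _ ⟨m, n, rfl⟩
    have h : (g : ℤ) ∣ j * n - k * m := by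
      have : (g : ℤ) ∣ Int.gcd j k := by rw [hg]; exact_mod_cast Nat.gcd_dvd_left _ _
      exact dvd_sub ((this.trans (Int.gcd_dvd_left j k)).mul_right _)
        ((this.trans (Int.gcd_dvd_right j k)).mul_right _)
    obtain ⟨a, ha⟩ := h
    exact ⟨a, by rw [hv, cross_mk, ha]; push_cast; rfl⟩
  have hmem : ∀ z s, Surface.mk d v z s ∈ Set.range (fun z => F z c) ↔
      z ∈ gauss ∨ ZMod.castHom hgd (ZMod g) s = ZMod.castHom hgd (ZMod g) c := by
    intro z s
    obtain ⟨t, ht, ht'⟩ := hF.exists_eq z s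
    rw [ht, hF.mem_range_iff hv hg hgd, ht' g hgd hcross]
  have hvol : ∀ s : ZMod d, MeasureTheory.volume
      {z : ℂ | z.re ∈ Set.Ico (0 : ℝ) 1 ∧ z.im ∈ Set.Ico (0 : ℝ) 1 ∧
        Surface.mk d v z s ∈ Set.range (fun z => F z c)} =
      if ZMod.castHom hgd (ZMod g) s = ZMod.castHom hgd (ZMod g) c then 1 else 0 := by
    intro s
    simp only [hmem]
    split_ifs with h
    · simpa [h] using volume_unitSquare
    · refine MeasureTheory.measure_mono_null ?_ volume_gauss
      rintro z ⟨-, -, hz⟩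
      exact hz.resolve_right h
  rw [Surface.area, tsum_congr hvol, tsum_fintype, Finset.sum_boole, card_castHom_fiber]
  obtain ⟨m, rfl⟩ := hgd
  rw [Nat.mul_div_cancel_left _ (Nat.pos_of_neZero g), mul_comm g,
    Nat.cast_mul, ENNReal.mul_div_cancel_right (by exact_mod_cast NeZero.ne g) (ENNReal.natCast_ne_top g)]

/-! ### Cylinders as images of unit strips. -/

/-- This computes the width: `a` unit steps, each shifting the label by `q`, return to the starting
label exactly when `d / gcd(q,d)` divides `a`. -/
theorem intCast_mul_intCast_eq_zero_iff {q : ℤ} {d e : ℕ} (hd : 1 ≤ d) (he : e = Int.gcd q d)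
    (hed : e ∣ d) (a : ℤ) :
    (a : ZMod d) * q = 0 ↔ ∃ n : ℤ, (a : ℝ) = n * ((d : ℝ) / (e : ℝ)) := by
  have he0 : (e : ℤ) ≠ 0 := by
    rintro h
    rw [Int.natCast_eq_zero.1 h] at hed
    have := Nat.eq_zero_of_zero_dvd hed
    omega
  have he0' : (e : ℝ) ≠ 0 := by exact_mod_cast he0
  rw [← Int.cast_mul, ZMod.intCast_zmod_eq_zero_iff_dvd]
  have hgcd := Int.gcd_eq_gcd_ab q d
  rw [← he] at hgcd
  obtain ⟨q', hq'⟩ : (e : ℤ) ∣ q := he ▸ Int.gcd_dvd_left ..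
  constructor
  · rintro ⟨y, hy⟩
    refine ⟨y * Int.gcdA q d + a * Int.gcdB q d, ?_⟩
    rw [← mul_div_assoc, eq_div_iff he0']
    have : a * e = (y * Int.gcdA q d + a * Int.gcdB q d) * d := by
      rw [hgcd]; linear_combination Int.gcdA q d * hy
    exact_mod_cast this
  · rintro ⟨n, hn⟩
    rw [← mul_div_assoc, eq_div_iff he0'] at hn
    have hn' : a * e = n * d := by exact_mod_cast hn
    refine ⟨n * q', ?_⟩
    rw [hq']
    linear_combination q' * hn'

theorem notMem_gauss_of_im_mem_Ioo {z : ℂ} (hz : z.im ∈ Set.Ioo (0 : ℝ) 1) : z ∉ gauss := by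
  rintro ⟨m, n, rfl⟩
  have h1 : (0 : ℝ) < n := by simpa using hz.1
  have h2 : (n : ℝ) < 1 := by simpa using hz.2
  have h1' : 0 < n := by exact_mod_cast h1
  have h2' : n < 1 := by exact_mod_cast h2
  omega

/-- The strip `0 < Im z < 1`, rotated by `u` and mapped to the surface by the chart `F · s`. -/
def band {d : ℕ} {v : ℂ} (F : ℂ → ZMod d → Surface d v) (u : ℂ) (s : ZMod d) : Set (Surface d v) :=
  {x | ∃ z : ℂ, z.im ∈ Set.Ioo (0 : ℝ) 1 ∧ x = F (u * z) s}

/-- The multiplication by `u` preserves the lattice, and the holonomy of the translation by `u`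
is `q`. -/
structure IsDirection (d : ℕ) (v u : ℂ) (q : ℤ) : Prop where
  ne_zero : u ≠ 0
  mul_mem_gauss_iff : ∀ z, u * z ∈ gauss ↔ z ∈ gauss
  crossMod_mul : ∀ a : ℤ, crossMod d v (u * a) = a * q

theorem isDirection_one (d : ℕ) (j k : ℤ) : IsDirection d (j + k * Complex.I) 1 (-k) where
  ne_zero := one_ne_zero
  mul_mem_gauss_iff z := by rw [one_mul]
  crossMod_mul a := by
    have := crossMod_mk d j k a 0
    simp only [Int.cast_zero, zero_mul, add_zero] at this
    rw [one_mul, this]; push_cast; ring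

theorem isDirection_I (d : ℕ) (j k : ℤ) : IsDirection d (j + k * Complex.I) Complex.I j where
  ne_zero := Complex.I_ne_zero
  mul_mem_gauss_iff z := by
    have h : ∀ z ∈ gauss, Complex.I * z ∈ gauss := by
      rintro _ ⟨m, n, rfl⟩
      refine ⟨-n, m, ?_⟩
      push_cast
      linear_combination (n : ℂ) * Complex.I_mul_I
    refine ⟨fun hz => ?_, h z⟩
    have := gauss.neg_mem (h _ hz)
    rwa [← mul_assoc, Complex.I_mul_I, neg_one_mul, neg_neg] at this
  crossMod_mul a := by
    have := crossMod_mk d j k 0 a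
    simp only [Int.cast_zero, zero_add] at this
    rw [mul_comm Complex.I (a : ℂ), this]; push_cast; ring

namespace IsUnfolding

variable {d : ℕ} {v : ℂ} {F : ℂ → ZMod d → Surface d v}

theorem continuous (hF : IsUnfolding d v F) (s : ZMod d) : Continuous fun z => F z s :=
  continuous_def.2 fun U hU => (hF.isOpen_iff U).1 hU s

/-- The preimage in any chart is a union of lattice translates of `B`; avoiding the lattice excludes
the extra identifications at the branch point. -/
theorem isOpen_image (hF : IsUnfolding d v F) {B : Set ℂ} (hB : IsOpen B)
    (hBg : ∀ z ∈ B, z ∉ gauss) (s : ZMod d) : IsOpen {x | ∃ z ∈ B, F z s = x} := by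
  rw [hF.isOpen_iff]
  intro t
  have : {z | F z t ∈ {x | ∃ z ∈ B, F z s = x}} =
      ⋃ l ∈ {l : ℂ | l ∈ gauss ∧ s - t = crossMod d v l}, {z | z + l ∈ B} := by
    ext z
    simp only [Set.mem_ofPred_eq, Set.mem_iUnion, exists_prop, hF.eq_iff]
    constructor
    · rintro ⟨w, hw, h, h'⟩
      exact ⟨w - z, ⟨h, h'.resolve_left (hBg w hw)⟩, by simpa⟩
    · rintro ⟨l, ⟨hl, hl'⟩, h⟩
      exact ⟨z + l, h, by simpa, Or.inr (by simpa)⟩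
  rw [this]
  exact isOpen_biUnion fun l _ => hB.preimage (continuous_id.add continuous_const)

/-- Over a regular point the chart label is determined by the lifted position. It varies
continuously in the discrete space `ZMod d`, so it is constant on a preconnected set. -/
theorem exists_lift (hF : IsUnfolding d v F) {X : Type*} [TopologicalSpace X] {S : Set X}
    (hS : IsPreconnected S) {f : X → Surface d v} (hf : ContinuousOn f S) {ζ : X → ℂ}
    (hζ : Continuous ζ) (hproj : ∀ p ∈ S, Surface.proj d v (f p) = (ζ p : BaseTorus))
    (hcone : ∀ p ∈ S, f p ∉ Surface.conePoints d v) :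
    (∀ p ∈ S, ζ p ∉ gauss) ∧ ∃ s, ∀ p ∈ S, f p = F (ζ p) s := by
  have hex : ∀ p ∈ S, ζ p ∉ gauss ∧ ∃ s, f p = F (ζ p) s := by
    intro p hp
    obtain ⟨z, s, hzs⟩ := hF.surjective (f p)
    have h1 : -z + ζ p ∈ gauss := by
      rw [← QuotientAddGroup.eq, ← hF.proj_eq z s, ← hzs]
      exact hproj p hp
    have h2 : z ∉ gauss := by
      rw [← hF.mem_conePoints z s, ← hzs]
      exact hcone p hp
    refine ⟨fun h => h2 ?_, s + crossMod d v (ζ p - z), ?_⟩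
    · simpa using gauss.sub_mem h h1
    · rw [hzs, eq_comm, hF.eq_iff]
      exact ⟨by rwa [sub_eq_neg_add], Or.inr (add_sub_cancel_left _ _)⟩
  refine ⟨fun p hp => (hex p hp).1, ?_⟩
  choose! σ hσ using fun p hp => (hex p hp).2
  have hcont : ContinuousOn σ S := by
    intro p hp
    rw [ContinuousWithinAt, nhds_discrete, Filter.tendsto_pure]
    obtain ⟨r, hr, hball⟩ := Metric.isOpen_iff.1 isClosed_gauss.isOpen_compl (ζ p) (hex p hp).1
    -- Radius at most 1/2 makes any two points of `B` less than 1 apart, so a lattice difference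
    -- between them is zero.
    set B := Metric.ball (ζ p) (min r (1 / 2))
    have hmem : ζ p ∈ B := Metric.mem_ball_self (by positivity)
    have hU := hF.isOpen_image (B := B) Metric.isOpen_ball
      (fun z hz => hball (Metric.ball_subset_ball (min_le_left _ _) hz)) (σ p)
    have h1 := (hf p hp).eventually (hU.mem_nhds ⟨ζ p, hmem, (hσ p hp).symm⟩)
    have h2 := (hζ.continuousWithinAt (s := S) (x := p)).eventually
      (Metric.isOpen_ball.mem_nhds hmem)
    filter_upwards [h1, h2, self_mem_nhdsWithin] with p' h1 h2 h3
    obtain ⟨w, hw, h1⟩ := h1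
    rw [hσ p' h3, hF.eq_iff] at h1
    have hlt : ‖w - ζ p'‖ < 1 := by
      rw [← dist_eq_norm]
      have hw' : dist w (ζ p) < 1 / 2 := lt_of_lt_of_le hw (min_le_right _ _)
      have hp' : dist (ζ p') (ζ p) < 1 / 2 := lt_of_lt_of_le h2 (min_le_right _ _)
      linarith [dist_triangle_right w (ζ p') (ζ p)]
    have h0 : w - ζ p' = 0 := by
      by_contra h0
      exact not_le.2 hlt (one_le_norm_of_mem_gauss h1.1 h0)
    have hwg : w ∉ gauss := by rw [sub_eq_zero.1 h0]; exact (hex p' h3).1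
    have h4 := h1.2.resolve_left hwg
    rw [h0, crossMod_zero, sub_eq_zero] at h4
    exact h4.symm
  rcases S.eq_empty_or_nonempty with rfl | ⟨p₀, hp₀⟩
  · exact ⟨0, by simp⟩
  · exact ⟨σ p₀, fun p hp => by rw [hσ p hp, hS.constant hcont hp hp₀]⟩

section Band

variable {u : ℂ} {q : ℤ}

/-- Heights in the open unit strip differ by less than 1, so a lattice vector joining two of its
points has no imaginary part. -/
theorem band_point_eq_iff (hF : IsUnfolding d v F) (hu : IsDirection d v u q) {z z' : ℂ}
    (hz : z.im ∈ Set.Ioo (0 : ℝ) 1) (hz' : z'.im ∈ Set.Ioo (0 : ℝ) 1) (s s' : ZMod d) :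
    F (u * z) s = F (u * z') s' ↔ ∃ a : ℤ, z - z' = a ∧ s - s' = a * q := by
  rw [hF.eq_iff, ← mul_sub, hu.mul_mem_gauss_iff, hu.mul_mem_gauss_iff,
    or_iff_right (notMem_gauss_of_im_mem_Ioo hz)]
  constructor
  · rintro ⟨⟨a, b, hab⟩, h⟩
    have hb : b = 0 := by
      have him : z.im - z'.im = b := by simpa using congrArg Complex.im hab
      have h1 : (b : ℝ) < 1 := by linarith [hz.2, hz'.1]
      have h2 : (-1 : ℝ) < b := by linarith [hz.1, hz'.2]
      have h1' : b < 1 := by exact_mod_cast h1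
      have h2' : -1 < b := by exact_mod_cast h2
      omega
    have hab' : z - z' = a := by simpa [hb] using hab
    exact ⟨a, hab', by rw [h, hab', hu.crossMod_mul]⟩
  · rintro ⟨a, ha, h⟩
    rw [ha, h, hu.crossMod_mul]
    exact ⟨intCast_mem_gauss a, rfl⟩

theorem band_eq_iff (hF : IsUnfolding d v F) (hu : IsDirection d v u q) {e : ℕ}
    (he : e = Int.gcd q d) (hed : e ∣ d) (s s' : ZMod d) :
    band F u s = band F u s' ↔
      ZMod.castHom hed (ZMod e) s = ZMod.castHom hed (ZMod e) s' := by
  have hsub : ∀ s s', ZMod.castHom hed (ZMod e) s = ZMod.castHom hed (ZMod e) s' →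
      band F u s ⊆ band F u s' := by
    intro s s' h
    rw [← sub_eq_zero, ← map_sub, castHom_eq_zero_iff he] at h
    obtain ⟨m, hm⟩ := h
    rintro _ ⟨z, hz, rfl⟩
    have hz' : (z - m).im ∈ Set.Ioo (0 : ℝ) 1 := by simpa using hz
    exact ⟨z - m, hz', (hF.band_point_eq_iff hu hz hz' s s').2 ⟨m, by ring, hm⟩⟩
  constructor
  · intro h
    -- Any single point of the strip determines the label class; `i/2` is a sample.
    have hI : (Complex.I / 2).im ∈ Set.Ioo (0 : ℝ) 1 := by norm_num
    have hx : F (u * (Complex.I / 2)) s ∈ band F u s' := h ▸ ⟨_, hI, rfl⟩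
    obtain ⟨z, hz, hx⟩ := hx
    obtain ⟨a, -, ha⟩ := (hF.band_point_eq_iff hu hI hz s s').1 hx
    rw [← sub_eq_zero, ← map_sub, castHom_eq_zero_iff he]
    exact ⟨a, ha⟩
  · intro h
    exact (hsub _ _ h).antisymm (hsub _ _ h.symm)

theorem band_eq_of_subset (hF : IsUnfolding d v F) (hu : IsDirection d v u q) {s s' : ZMod d}
    (h : band F u s ⊆ band F u s') : band F u s = band F u s' := by
  have hI : (Complex.I / 2).im ∈ Set.Ioo (0 : ℝ) 1 := by norm_num
  obtain ⟨z, hz, hx⟩ := h ⟨_, hI, rfl⟩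
  obtain ⟨a, -, ha⟩ := (hF.band_point_eq_iff hu hI hz s s').1 hx
  have hed : Int.gcd q d ∣ d := by exact_mod_cast Int.gcd_dvd_right q d
  rw [hF.band_eq_iff hu rfl hed, ← sub_eq_zero, ← map_sub, castHom_eq_zero_iff rfl]
  exact ⟨a, ha⟩

theorem isCylinder_band (hd : 1 ≤ d) (hF : IsUnfolding d v F) (hu : IsDirection d v u q) {e : ℕ}
    (he : e = Int.gcd q d) (hed : e ∣ d) (s : ZMod d) :
    Surface.IsCylinder u ((d : ℝ) / (e : ℝ)) 1 (band F u s) := by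
  have hdpos : (0 : ℝ) < d := by exact_mod_cast hd
  have hepos : (0 : ℝ) < e := by exact_mod_cast Nat.pos_of_dvd_of_pos hed hd
  have him : ∀ x y : ℝ, ((x : ℂ) + y * Complex.I).im = y := fun x y => by simp
  refine ⟨by positivity, one_pos, fun p => F (u * ((p.1 : ℂ) + p.2 * Complex.I)) s, 0,
    ?_, ?_, ?_, ?_, ?_⟩
  · exact ((hF.continuous s).comp (by fun_prop)).continuousOn
  · ext x
    constructor
    · rintro ⟨⟨a, b⟩, ⟨-, hb⟩, rfl⟩
      exact ⟨_, by rw [him]; exact hb, rfl⟩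
    · rintro ⟨z, hz, rfl⟩
      exact ⟨(z.re, z.im), ⟨trivial, hz⟩, by simp [Complex.re_add_im]⟩
  · rw [Set.eq_empty_iff_forall_notMem]
    rintro _ ⟨⟨z, hz, rfl⟩, h⟩
    rw [hF.mem_conePoints, hu.mul_mem_gauss_iff] at h
    exact notMem_gauss_of_im_mem_Ioo hz h
  · intro x y _
    rw [zero_add, hF.proj_eq]
  · intro x x' y hy y' hy'
    rw [← him x y] at hy
    rw [← him x' y'] at hy'
    rw [hF.band_point_eq_iff hu hy hy', sub_self]
    constructor
    · rintro ⟨a, ha, h⟩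
      have hre : x - x' = a := by simpa using congrArg Complex.re ha
      have himm : y - y' = 0 := by simpa using congrArg Complex.im ha
      obtain ⟨n, hn⟩ := (intCast_mul_intCast_eq_zero_iff hd he hed a).1 h.symm
      exact ⟨sub_eq_zero.1 himm, n, hre.trans hn⟩
    · rintro ⟨rfl, n, hn⟩
      obtain ⟨c, hc⟩ := id hed
      have hcr : (d : ℝ) / e = (c : ℤ) := by
        rw [div_eq_iff hepos.ne', hc]; push_cast; ring
      have ha : x - x' = ((n * c : ℤ) : ℝ) := by rw [hn, hcr]; push_cast; ring
      refine ⟨n * c, ?_, ((intCast_mul_intCast_eq_zero_iff hd he hed _).2 ⟨n, ?_⟩).symm⟩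
      · rw [add_sub_add_right_eq_sub, ← Complex.ofReal_sub, ha, Complex.ofReal_intCast]
      · rw [← ha, hn]

/-- The cylinder lifts to a full strip, infinite in direction `u`, that avoids the lattice, so it
cannot contain a lattice line and fits between two consecutive ones. -/
theorem exists_subset_band (hF : IsUnfolding d v F) (hu : IsDirection d v u q) {w h : ℝ}
    {C : Set (Surface d v)} (hC : Surface.IsCylinder u w h C) : ∃ s, C ⊆ band F u s := by
  obtain ⟨-, hh, f, z₀, hf, rfl, hcone, hproj, -⟩ := hC
  set ζ : ℝ × ℝ → ℂ := fun p => z₀ + u * ((p.1 : ℂ) + p.2 * Complex.I) with hζ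
  obtain ⟨hreg, s, hs⟩ := hF.exists_lift (isPreconnected_univ.prod isPreconnected_Ioo) hf
    (ζ := ζ) (by fun_prop) (fun p hp => hproj p.1 p.2 hp.2)
    (fun p hp hp' => (Set.eq_empty_iff_forall_notMem.1 hcone) _ ⟨⟨p, hp, rfl⟩, hp'⟩)
  -- Translating by `u m i` brings the lower edge of the strip to a height in `[0, 1)`.
  set m : ℤ := ⌊(z₀ / u).im⌋ with hm
  set z₁ : ℂ := z₀ / u - m * Complex.I with hz₁
  have hz₁im : z₁.im = Int.fract (z₀ / u).im := by
    simp [hz₁, hm]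
  have h0 : 0 ≤ z₁.im := hz₁im ▸ Int.fract_nonneg _
  have h1 : z₁.im < 1 := hz₁im ▸ Int.fract_lt_one _
  have hmI : (m : ℂ) * Complex.I ∈ gauss := ⟨0, m, by simp⟩
  have hζ₁ : ∀ p, ζ p = u * (z₁ + (p.1 + p.2 * Complex.I)) + u * (m * Complex.I) := by
    intro p
    have hz₀ : z₀ = u * (z₀ / u) := (mul_div_cancel₀ z₀ hu.ne_zero).symm
    simp only [hζ, hz₁]
    linear_combination hz₀
  have htop : z₁.im + h ≤ 1 := by
    by_contra hlt
    push Not at hlt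
    -- At these coordinates the translated strip would contain the lattice point `u i`.
    refine hreg (-z₁.re, 1 - z₁.im) ⟨trivial, by linarith, by linarith⟩ ?_
    rw [hζ₁, ← mul_add, hu.mul_mem_gauss_iff]
    refine gauss.add_mem ⟨0, 1, ?_⟩ hmI
    apply Complex.ext <;> simp
  refine ⟨s - crossMod d v (u * (m * Complex.I)), ?_⟩
  rintro _ ⟨⟨x, y⟩, ⟨-, hy⟩, rfl⟩
  refine ⟨z₁ + (x + y * Complex.I), ?_, ?_⟩
  · have : (z₁ + (x + y * Complex.I)).im = z₁.im + y := by simp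
    rw [this]
    exact ⟨by linarith [hy.1], by linarith [hy.2]⟩
  · rw [hs (x, y) ⟨trivial, hy⟩, hF.eq_iff, hζ₁, add_sub_cancel_left, hu.mul_mem_gauss_iff]
    exact ⟨hmI, Or.inr (sub_sub_cancel _ _)⟩

theorem isMaximalCylinder_iff (hd : 1 ≤ d) (hF : IsUnfolding d v F) (hu : IsDirection d v u q)
    (C : Set (Surface d v)) :
    Surface.IsMaximalCylinder u C ↔ ∃ s, C = band F u s := by
  have hed : Int.gcd q d ∣ d := by exact_mod_cast Int.gcd_dvd_right q d
  constructor
  · rintro ⟨⟨w, h, hC⟩, hmax⟩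
    obtain ⟨s, hs⟩ := hF.exists_subset_band hu hC
    exact ⟨s, (hmax _ _ _ (hF.isCylinder_band hd hu rfl hed s) hs).symm⟩
  · rintro ⟨s, rfl⟩
    refine ⟨⟨_, _, hF.isCylinder_band hd hu rfl hed s⟩, fun C' w' h' hC' hsub => ?_⟩
    obtain ⟨s', hs'⟩ := hF.exists_subset_band hu hC'
    have := hF.band_eq_of_subset hu (hsub.trans hs')
    exact (hs'.trans this.ge).antisymm hsub

theorem band_subset_range_iff {j k : ℤ} (hF : IsUnfolding d v F) (hu : IsDirection d v u q)
    (hv : v = j + k * Complex.I) {g : ℕ} (hg : g = Nat.gcd (Int.gcd j k) d) (hgd : g ∣ d)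
    (s c : ZMod d) : band F u s ⊆ Set.range (fun z => F z c) ↔
      ZMod.castHom hgd (ZMod g) s = ZMod.castHom hgd (ZMod g) c := by
  constructor
  · intro h
    have hI : (Complex.I / 2).im ∈ Set.Ioo (0 : ℝ) 1 := by norm_num
    have hx := h ⟨_, hI, rfl⟩
    rw [hF.mem_range_iff hv hg hgd, hu.mul_mem_gauss_iff] at hx
    exact hx.resolve_left (notMem_gauss_of_im_mem_Ioo hI)
  · rintro h _ ⟨z, hz, rfl⟩
    rw [hF.mem_range_iff hv hg hgd]
    exact Or.inr h

/-- Bands correspond to `ZMod e`, and those in the torus of `c` form one fibre of `ZMod e → ZMod g`.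
-/
theorem maximalCylinders {j k : ℤ} (hd : 1 ≤ d) (hF : IsUnfolding d v F)
    (hu : IsDirection d v u q) (hv : v = j + k * Complex.I) {g : ℕ}
    (hg : g = Nat.gcd (Int.gcd j k) d) {e : ℕ} (he : e = Int.gcd q d) (hge : g ∣ e) (c : ZMod d) :
    Set.ncard {C | Surface.IsMaximalCylinder u C ∧ C ⊆ Set.range (fun z => F z c)} = e / g ∧
      ∀ C, Surface.IsMaximalCylinder u C → C ⊆ Set.range (fun z => F z c) →
        ∃ h : ℝ, Surface.IsCylinder u ((d : ℝ) / (e : ℝ)) h C := by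
  have hed : e ∣ d := by rw [he]; exact_mod_cast Int.gcd_dvd_right q d
  have hgd := hge.trans hed
  have : NeZero d := ⟨by omega⟩
  have : NeZero e := ⟨by rintro rfl; simp at hed; omega⟩
  have : NeZero g := ⟨by rintro rfl; simp at hgd; omega⟩
  refine ⟨?_, ?_⟩
  · have hcast : ∀ t : ZMod e, ZMod.castHom hed (ZMod e) ((t.val : ℕ) : ZMod d) = t := by
      intro t
      rw [map_natCast, ZMod.natCast_zmod_val]
    have hcomp : ∀ s : ZMod d, ZMod.castHom hgd (ZMod g) s =
        ZMod.castHom hge (ZMod g) (ZMod.castHom hed (ZMod e) s) := by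
      intro s
      obtain ⟨x, rfl⟩ := ZMod.intCast_surjective s
      simp only [map_intCast]
    have hset : {C | Surface.IsMaximalCylinder u C ∧ C ⊆ Set.range (fun z => F z c)} =
        (fun t : ZMod e => band F u ((t.val : ℕ) : ZMod d)) ''
          (Finset.univ.filter fun t : ZMod e => ZMod.castHom hge (ZMod g) t =
            ZMod.castHom hgd (ZMod g) c : Finset (ZMod e)) := by
      ext C
      simp only [Set.mem_ofPred_eq, hF.isMaximalCylinder_iff hd hu, Set.mem_image,
        Finset.coe_filter, Finset.mem_univ, true_and]
      constructor
      · rintro ⟨⟨s, rfl⟩, h⟩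
        rw [hF.band_subset_range_iff hu hv hg hgd, hcomp] at h
        refine ⟨ZMod.castHom hed (ZMod e) s, h, ?_⟩
        rw [hF.band_eq_iff hu he hed, hcast]
      · rintro ⟨t, ht, rfl⟩
        refine ⟨⟨_, rfl⟩, ?_⟩
        rw [hF.band_subset_range_iff hu hv hg hgd, hcomp, hcast, ht]
    rw [hset, Set.InjOn.ncard_image, Set.ncard_coe_finset, card_castHom_fiber]
    intro t _ t' _ h
    rwa [hF.band_eq_iff hu he hed, hcast, hcast] at h
  · intro C hC _
    obtain ⟨s, rfl⟩ := (hF.isMaximalCylinder_iff hd hu C).1 hC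
    exact ⟨1, hF.isCylinder_band hd hu he hed s⟩

end Band

end IsUnfolding

end DSym

theorem mainTheorem7 (d : ℕ) (hd : 1 ≤ d) (j k : ℤ) (v : ℂ)
    (hv : v = (j : ℂ) + (k : ℂ) * Complex.I) (g : ℕ) (hg : g = Nat.gcd (Int.gcd j k) d) :
    ∃ (Λ : Fin g → AddSubgroup ℂ) (φ : DSym.TorusUnion Λ ≃ₜ DSym.Surface d v)
      (T : Fin g → Set (DSym.Surface d v)),
      (∀ c, DSym.IsLattice (Λ c) ∧ Λ c ≤ DSym.gauss) ∧
      (∀ (c : Fin g) (z : ℂ),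
        DSym.Surface.proj d v (φ (DSym.TorusUnion.mk Λ c z)) = (z : DSym.BaseTorus)) ∧
      (∀ c, T c = Set.range (fun z : ℂ => φ (DSym.TorusUnion.mk Λ c z))) ∧
      (∀ c, DSym.Surface.area (T c) = (d : ENNReal) / (g : ENNReal)) ∧
      (∀ c,
        Set.ncard {C | DSym.Surface.IsMaximalCylinder 1 C ∧ C ⊆ T c} = Int.gcd k d / g ∧
        ∀ C, DSym.Surface.IsMaximalCylinder 1 C → C ⊆ T c →
          ∃ h : ℝ, DSym.Surface.IsCylinder 1 ((d : ℝ) / (Int.gcd k d : ℝ)) h C) ∧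
      (∀ c,
        Set.ncard {C | DSym.Surface.IsMaximalCylinder Complex.I C ∧ C ⊆ T c} = Int.gcd j d / g ∧
        ∀ C, DSym.Surface.IsMaximalCylinder Complex.I C → C ⊆ T c →
          ∃ h : ℝ, DSym.Surface.IsCylinder Complex.I ((d : ℝ) / (Int.gcd j d : ℝ)) h C) := by
  have hvg : v ∈ DSym.gauss := ⟨j, k, hv⟩
  obtain ⟨F, hF⟩ := DSym.exists_isUnfolding d hd hvg
  obtain ⟨φ, hφ⟩ := hF.exists_homeomorph hd hvg hv hg
  have hgk : g ∣ Int.gcd (-k) d := by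
    rw [hg, Int.neg_gcd]
    exact Int.dvd_gcd ((Int.natCast_dvd_natCast.2 (Nat.gcd_dvd_left _ _)).trans
      (Int.gcd_dvd_right j k)) (Int.natCast_dvd_natCast.2 (Nat.gcd_dvd_right _ _))
  have hgj : g ∣ Int.gcd j d := by
    rw [hg]
    exact Int.dvd_gcd ((Int.natCast_dvd_natCast.2 (Nat.gcd_dvd_left _ _)).trans
      (Int.gcd_dvd_left j k)) (Int.natCast_dvd_natCast.2 (Nat.gcd_dvd_right _ _))
  refine ⟨_, φ, fun c => Set.range fun z => F z (c : ℕ),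
    fun _ => ⟨DSym.isLattice_crossKernel hd hvg, DSym.crossKernel_le d hvg⟩,
    fun c z => by rw [hφ, hF.proj_eq], fun c => by simp only [hφ],
    fun c => hF.area_range hd hv hg _, fun c => ?_, fun c => ?_⟩
  · have hu : DSym.IsDirection d v 1 (-k) := hv ▸ DSym.isDirection_one d j k
    rw [← Int.neg_gcd]
    exact hF.maximalCylinders hd hu hv hg rfl hgk _
  · have hu : DSym.IsDirection d v Complex.I j := hv ▸ DSym.isDirection_I d j k
    exact hF.maximalCylinders hd hu hv hg rfl hgj _
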